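/- **Definitions.** For a finite poset $P$ let $J(P)$ be the distributive lattice of order ideals of $P$, ordered by containment; every finite distributive lattice is $J(P)$ for a finite poset $P$ that is unique up to isomorphism. A probability distribution $\mu$ on $J(P)$ is *toggle-symmetric* if for every $p\in P$ the probability that $p$ is a minimal element of $P\setminus I$ equals the probability that $p$ is a maximal element of $I$, when $I\sim\mu$. For a finite poset $L$ and $x \in L$, let $\mathrm{ddeg}(x)$ be the number of elements of $L$ covered by $x$; the *edge density* of $L$ is the expectation of $\mathrm{ddeg}$ with respect to the uniform distribution on $L$. The distributive lattice $J(P)$ is *tCDE* (toggle-CDE) if for every toggle-symmetric probability distribution on $J(P)$ the expectation of $\mathrm{ddeg}$ equals the edge density of $J(P)$. A partition is *strict* if its nonzero parts are distinct. For a strict partition $\lambda$, let $[\varnothing,\lambda]_{\mathrm{shift}}$ be the set of strict partitions $\rho$ with $\rho_i\le\lambda_i$ for all $i$, ordered by containment of Young diagrams (that is, $\rho\subseteq\rho'$ iff $\rho_i\le\rho'_i$ for all $i$). Sums of partitions are taken part by part; $\delta_n=(n,n-1,\ldots,1)$, and $b^n=(b,\ldots,b)$ with $n$ parts. Let $\nu$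 be a partition, viewed as a straight shape (English notation). Its *height* $a$ is its number of nonzero parts and its *width* $b$ is its largest part ($a=b=0$ if $\nu=\varnothing$). Use matrix coordinates on lattice points, with $(0,0)$ the northwest corner and $(a,b)$ the southeast corner of the $a\times b$ rectangle containing $\nu$. The shape $\nu$ is *balanced* if every lattice point at which a north step is followed by an east step, on the southeast border of $\nu$ traversed from $(a,0)$ to $(0,b)$, lies on the line through $(a,0)$ and $(0,b)$. **Theorem.** Let $0\le k<n$ be integers and let $\nu$ be a (not necessarily strict) partition which, as a straight shape, is balanced with height and width both equal to $k$. 1. For $\lambda:=\delta_n+\nu$, the poset $[\varnothing,\lambda]_{\mathrm{shift}}$ is a distributive lattice which is tCDE with edge density $\dfrac{n+1+k}{4}$. 2. For $\lambda:=\delta_n+\nu+(n-1-k)^n$, the poset $[\varnothing,\lambda]_{\mathrm{shift}}$ is a distributive lattice which is tCDE with edge density $\dfrac{n}{2}$. -/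

import Mathlib

/-! ## Expectations, down-degree and edge density of a finite poset -/

/-- The expectation `𝔼(μ; f) = ∑ x, f x * μ x` of a statistic `f` with respect to a distribution
`μ` on a finite set. Probability distributions are the elements of `stdSimplex ℝ α`. -/
def expectation {α : Type*} [Fintype α] (μ f : α → ℝ) : ℝ :=
  ∑ x, f x * μ x

/-- The uniform distribution. -/
noncomputable def uniformDist (α : Type*) [Fintype α] : α → ℝ :=
  fun _ => 1 / (Fintype.card α : ℝ)

/-- The down-degree of `p`: the number of elements covered by `p`. -/
noncomputable def ddeg {α : Type*} [PartialOrder α] (p : α) : ℕ :=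
  Nat.card {q : α // q ⋖ p}

/-- The edge density `𝔼(uni; ddeg)` of a finite poset. -/
noncomputable def edgeDensity (α : Type*) [PartialOrder α] [Fintype α] : ℝ :=
  expectation (uniformDist α) (fun p => (ddeg p : ℝ))

/-! ## Order ideals and toggle-symmetry

The distributive lattice `J(P)` of order ideals of a poset `P` is Mathlib's `LowerSet P`. -/

noncomputable instance instFintypeLowerSet {P : Type*} [PartialOrder P] [Fintype P] :
    Fintype (LowerSet P) :=
  @Fintype.ofFinite _ (Finite.of_injective (fun I : LowerSet P => (I : Set P))
    SetLike.coe_injective)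

/-- `p` can be toggled into `I`: it is a minimal element of the complement of `I`. -/
def CanToggleIn {P : Type*} [PartialOrder P] (p : P) (I : LowerSet P) : Prop :=
  Minimal (fun q => q ∉ I) p

/-- `p` can be toggled out of `I`: it is a maximal element of `I`. -/
def CanToggleOut {P : Type*} [PartialOrder P] (p : P) (I : LowerSet P) : Prop :=
  Maximal (fun q => q ∈ I) p

open Classical in
/-- The toggleability statistic `𝒯⁺ₚ`. -/
noncomputable def togglePlus {P : Type*} [PartialOrder P] (p : P) (I : LowerSet P) : ℝ :=
  if CanToggleIn p I then 1 else 0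

open Classical in
/-- The toggleability statistic `𝒯⁻ₚ`. -/
noncomputable def toggleMinus {P : Type*} [PartialOrder P] (p : P) (I : LowerSet P) : ℝ :=
  if CanToggleOut p I then 1 else 0

/-- A distribution `μ` on `J(P)` is toggle-symmetric if every `p` is as likely to be toggled into
as out of a `μ`-random order ideal. -/
def IsToggleSymmetric {P : Type*} [PartialOrder P] [Fintype P] (μ : LowerSet P → ℝ) : Prop :=
  ∀ p : P, expectation μ (togglePlus p) = expectation μ (toggleMinus p)

/-- `J(P)` is toggle-CDE: every toggle-symmetric probability distribution on `J(P)` has the same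
expected down-degree as the uniform distribution. -/
def OrderIdealsToggleCDE (P : Type*) [PartialOrder P] [Fintype P] : Prop :=
  ∀ μ ∈ stdSimplex ℝ (LowerSet P), IsToggleSymmetric μ →
    expectation μ (fun I => (ddeg I : ℝ)) = edgeDensity (LowerSet P)

universe u

/-- A poset `L` is a tCDE distributive lattice: `L` is isomorphic to `J(P)` for a finite poset `P`
(which is then unique up to isomorphism), and `J(P)` is toggle-CDE. -/
def IsToggleCDE (L : Type u) [PartialOrder L] : Prop :=
  ∃ (P : Type u) (_ : PartialOrder P) (_ : Fintype P),
    Nonempty (L ≃o LowerSet P) ∧ OrderIdealsToggleCDE P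

/-! ## Partitions

Partitions are identified with Mathlib's Young diagrams (English notation, matrix coordinates
starting at `0`), so that Young's lattice is `YoungDiagram` with its order `≤` (containment) and
the parts of `ν` are `ν.rowLen 0 ≥ ν.rowLen 1 ≥ ⋯`. -/

/-- The partition with parts `f 0 ≥ f 1 ≥ ⋯ ≥ f (n - 1)`, the rest being zero. -/
def partitionOfParts (f : ℕ → ℕ) (hf : Antitone f) (n : ℕ) (_hn : f n = 0) : YoungDiagram where
  cells := (Finset.range n ×ˢ Finset.range (f 0)).filter (fun c => c.2 < f c.1)
  isLowerSet := by
    rintro ⟨i, j⟩ ⟨i', j'⟩ ⟨hi, hj⟩ h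
    simp only [Finset.coe_filter, Finset.mem_product, Finset.mem_range, Set.mem_ofPred_eq] at h ⊢
    have h1 := hf hi
    simp only at hi hj h1
    have h2 : f i' ≤ f 0 := hf (Nat.zero_le _)
    omega

theorem rowLen_partitionOfParts (f : ℕ → ℕ) (hf : Antitone f) (n : ℕ) (hn : f n = 0) (i : ℕ) :
    (partitionOfParts f hf n hn).rowLen i = f i := by
  refine eq_of_forall_lt_iff fun j => ?_
  rw [← YoungDiagram.mem_iff_lt_rowLen, ← YoungDiagram.mem_cells]
  simp only [partitionOfParts, Finset.mem_filter, Finset.mem_product, Finset.mem_range]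
  refine ⟨fun h => h.2, fun h => ⟨⟨?_, h.trans_le (hf (Nat.zero_le i))⟩, h⟩⟩
  by_contra hi
  have := hf (not_lt.1 hi)
  omega

theorem rowLen_eq_zero_of_colLen_le (ν : YoungDiagram) (i : ℕ) (h : ν.colLen 0 ≤ i) :
    ν.rowLen i = 0 := by
  by_contra h0
  have h1 : (i, 0) ∈ ν := YoungDiagram.mem_iff_lt_rowLen.2 (Nat.pos_of_ne_zero h0)
  exact absurd (YoungDiagram.mem_iff_lt_colLen.1 h1) (not_lt.2 h)

/-- The sum `ν + κ` of partitions, formed part by part. -/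
def partitionAdd (ν κ : YoungDiagram) : YoungDiagram :=
  partitionOfParts (fun i => ν.rowLen i + κ.rowLen i)
    (fun i j h => Nat.add_le_add (ν.rowLen_anti i j h) (κ.rowLen_anti i j h))
    (max (ν.colLen 0) (κ.colLen 0)) (by
      rw [rowLen_eq_zero_of_colLen_le ν _ (le_max_left _ _),
        rowLen_eq_zero_of_colLen_le κ _ (le_max_right _ _)])

/-- The staircase `δ_n = (n, n - 1, …, 1)`. -/
def staircase (n : ℕ) : YoungDiagram :=
  partitionOfParts (fun i => n - i) (fun _ _ h => Nat.sub_le_sub_left h n) n (Nat.sub_self n)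

/-- The rectangle `b^a = (b, …, b)` with `a` parts. -/
def rectangle (a b : ℕ) : YoungDiagram :=
  partitionOfParts (fun i => if i < a then b else 0)
    (fun i j h => by dsimp only; split_ifs <;> omega) a (if_neg (lt_irrefl a))

theorem rowLen_partitionAdd (ν κ : YoungDiagram) (i : ℕ) :
    (partitionAdd ν κ).rowLen i = ν.rowLen i + κ.rowLen i :=
  rowLen_partitionOfParts _ _ _ _ i

theorem rowLen_staircase (n i : ℕ) : (staircase n).rowLen i = n - i :=
  rowLen_partitionOfParts _ _ _ _ i

theorem rowLen_rectangle (a b i : ℕ) : (rectangle a b).rowLen i = if i < a then b else 0 :=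
  rowLen_partitionOfParts _ _ _ _ i

/-! ## Balanced straight shapes -/

/-- The height of a straight shape is its number of nonzero parts. -/
def height (ν : YoungDiagram) : ℕ := ν.colLen 0

/-- The width of a straight shape is its first part. -/
def width (ν : YoungDiagram) : ℕ := ν.rowLen 0

/-- The southeast border of `ν`, a lattice path from `(height ν, 0)` to `(0, width ν)`, contains the
north step from the lattice point `(i + 1, j)` to `(i, j)`. -/
def HasNorthStep (ν : YoungDiagram) (i j : ℕ) : Prop :=
  i < height ν ∧ ν.rowLen i = j

/-- The southeast border of `ν` contains the east step from the lattice point `(i, j)` to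
`(i, j + 1)`. -/
def HasEastStep (ν : YoungDiagram) (i j : ℕ) : Prop :=
  j < width ν ∧ ν.colLen j = i

/-- An outward corner of a straight shape occurs at `(i, j)`: a north step followed by an east step
of the southeast border. (The northwest border of a straight shape consists of north steps followed
by east steps, so a straight shape has no northwest outward corners.) -/
def HasOutwardCorner (ν : YoungDiagram) (i j : ℕ) : Prop :=
  HasNorthStep ν i j ∧ HasEastStep ν i j

/-- `ν` is balanced: each of its outward corners lies on the main anti-diagonal, the line through
`(a, 0)` and `(0, b)`, where `a` is the height and `b` the width. -/
def IsBalanced (ν : YoungDiagram) : Prop :=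
  ∀ i j : ℕ, HasOutwardCorner ν i j → i * width ν + j * height ν = height ν * width ν

/-! ## The shifted Young's lattice -/

/-- A partition is strict if its nonzero parts are strictly decreasing. -/
def IsStrict (l : YoungDiagram) : Prop :=
  ∀ i, l.rowLen i ≠ 0 → l.rowLen (i + 1) < l.rowLen i

/-- The shifted Young's lattice: the strict partitions, ordered by containment. -/
abbrev StrictPartition : Type := {l : YoungDiagram // IsStrict l}

/-- The empty partition. -/
def emptyStrict : StrictPartition :=
  ⟨⊥, fun i h => absurd (YoungDiagram.mem_iff_lt_rowLen.2 (Nat.pos_of_ne_zero h))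
    (YoungDiagram.notMem_bot (i, 0))⟩

/-- The initial interval `[∅, l]` of the shifted Young's lattice. -/
abbrev ShiftedInterval (l : StrictPartition) : Type := Set.Icc emptyStrict l

noncomputable instance instFintypeShiftedInterval (l : StrictPartition) :
    Fintype (ShiftedInterval l) :=
  @Fintype.ofFinite _ (Finite.of_injective
    (fun x : ShiftedInterval l =>
      (⟨x.1.1.cells, Finset.mem_powerset.2 (YoungDiagram.cells_subset_iff.2 x.2.2)⟩ :
        l.1.cells.powerset))
    (fun _ _ h => Subtype.ext (Subtype.ext (YoungDiagram.ext (congrArg Subtype.val h)))))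

/-- Adding to `δ_n` a partition with at most `n` parts gives a strict partition. -/
theorem isStrict_staircase_add (n : ℕ) (ν : YoungDiagram) (h : height ν ≤ n) :
    IsStrict (partitionAdd (staircase n) ν) := by
  intro i hi
  simp only [rowLen_partitionAdd, rowLen_staircase] at hi ⊢
  have h1 := ν.rowLen_anti i (i + 1) (Nat.le_succ i)
  have h2 : n ≤ i → ν.rowLen i = 0 := fun h3 =>
    rowLen_eq_zero_of_colLen_le ν i (h.trans h3)
  omega

/-- Adding moreover a rectangle with `n` rows gives a strict partition. -/
theorem isStrict_staircase_add_add_rectangle (n b : ℕ) (ν : YoungDiagram) (h : height ν ≤ n) :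
    IsStrict (partitionAdd (partitionAdd (staircase n) ν) (rectangle n b)) := by
  intro i hi
  simp only [rowLen_partitionAdd, rowLen_staircase, rowLen_rectangle] at hi ⊢
  have h1 := ν.rowLen_anti i (i + 1) (Nat.le_succ i)
  have h2 : n ≤ i → ν.rowLen i = 0 := fun h3 =>
    rowLen_eq_zero_of_colLen_le ν i (h.trans h3)
  split_ifs at hi ⊢ <;> omega

/-- The strict partition `δ_n + ν`. -/
def stairPlus (n : ℕ) (ν : YoungDiagram) (h : height ν ≤ n) : StrictPartition :=
  ⟨partitionAdd (staircase n) ν, isStrict_staircase_add n ν h⟩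

/-- The strict partition `δ_n + ν + b^n`. -/
def stairPlusRect (n b : ℕ) (ν : YoungDiagram) (h : height ν ≤ n) : StrictPartition :=
  ⟨partitionAdd (partitionAdd (staircase n) ν) (rectangle n b),
    isStrict_staircase_add_add_rectangle n b ν h⟩

/-! In `J(P)` the down-degree of `I` is the sum over `p` of `toggleMinus p I`. If coefficients `c p`
make the sum of `c p * togglePlus p I + (1 - c p) * toggleMinus p I` equal to a constant `K` for
every `I`, then the down-degree is `K` plus a combination of the differences `toggleMinus p -
togglePlus p`. These have mean zero under any toggle-symmetric distribution. The uniform one is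
toggle-symmetric, so `J(P)` is tCDE with edge density `K`.

The interval below a strict partition is `J(P)` for `P` the poset of boxes of its shifted shape. Let
`s` be the first part. The coefficient of the box in row `i` and column `j` is `(s - i - j) / 2` off
the main diagonal and `(s + 1 - 2 * i) / 4` on it. For a strict partition inside the shape, the box
removable from row `i` and the box addable to row `i + 1` together contribute a difference of two
terms, each depending on a single row end (`rowMinus_add_rowPlus_succ`). The sum over rows
telescopes to `K = (s + 1) / 4`.

The one obstruction is a box that would be addable but lies outside the shape, so that its term is
missing. `IsShiftedBalanced` says exactly that the coefficient formula vanishes there. Both families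
of the theorem satisfy it, with `s = n + k` and `s = 2 * n - 1` respectively. -/

/-! ### Toggles, down-degree and toggle-symmetric distributions on `J(P)` -/

section OrderIdeals

variable {P : Type*} [PartialOrder P]

theorem mem_lowerSet_erase {p q : P} {I : LowerSet P} : q ∈ I.erase p ↔ q ∈ I ∧ ¬ p ≤ q :=
  Iff.rfl

theorem CanToggleOut.mem_erase {p q : P} {I : LowerSet P} (h : CanToggleOut p I) :
    q ∈ I.erase p ↔ q ∈ I ∧ q ≠ p := by
  rw [mem_lowerSet_erase]
  refine and_congr_right fun hq => not_congr ⟨fun hpq => le_antisymm (h.2 hq hpq) hpq, ?_⟩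
  rintro rfl
  exact le_rfl

theorem CanToggleOut.erase_covBy {p : P} {I : LowerSet P} (h : CanToggleOut p I) :
    I.erase p ⋖ I := by
  refine ⟨LowerSet.erase_lt.2 h.1, fun J hJ hJI => ?_⟩
  obtain ⟨q, hqJ, hq⟩ := Set.exists_of_ssubset (LowerSet.coe_ssubset_coe.2 hJ)
  have hqp : q = p := by
    by_contra hne
    exact hq (h.mem_erase.2 ⟨hJI.le hqJ, hne⟩)
  subst hqp
  refine hJI.not_ge fun r hr => ?_
  by_cases hrq : r = q
  · rwa [hrq]
  · exact hJ.le (h.mem_erase.2 ⟨hr, hrq⟩)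

theorem exists_canToggleOut_of_covBy [Finite P] {I J : LowerSet P} (h : J ⋖ I) :
    ∃ p, CanToggleOut p I ∧ I.erase p = J := by
  obtain ⟨q, hqI, hqJ⟩ := Set.exists_of_ssubset (LowerSet.coe_ssubset_coe.2 h.lt)
  obtain ⟨p, hqp, hp⟩ := (Set.toFinite (I : Set P)).exists_le_maximal hqI
  have hpJ : p ∉ J := fun hpJ => hqJ (J.lower hqp hpJ)
  have hle : J ≤ I.erase p := fun r hr =>
    mem_lowerSet_erase.2 ⟨h.le hr, fun hpr => hpJ (J.lower hpr hr)⟩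
  exact ⟨p, hp, (h.eq_or_eq hle LowerSet.erase_le).resolve_right
    (LowerSet.erase_lt.2 hp.1).ne⟩

/-- The ideals covered by `I` arise by erasing one maximal element, and different elements give
different ideals. -/
theorem ddeg_lowerSet [Fintype P] (I : LowerSet P) : (ddeg I : ℝ) = ∑ p, toggleMinus p I := by
  classical
  have h : ddeg I = Nat.card {p // CanToggleOut p I} := by
    refine (Nat.card_congr (Equiv.ofBijective
      (fun p : {p // CanToggleOut p I} => (⟨I.erase p, p.2.erase_covBy⟩ : {J // J ⋖ I}))
      ⟨fun p q hpq => ?_, fun J => ?_⟩)).symm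
    · by_contra hne
      have h1 : (p : P) ∈ I.erase q := q.2.mem_erase.2 ⟨p.2.1, fun h => hne (Subtype.ext h)⟩
      rw [← show I.erase p = I.erase q from congrArg Subtype.val hpq] at h1
      exact (p.2.mem_erase.1 h1).2 rfl
    · obtain ⟨p, hp, hpJ⟩ := exists_canToggleOut_of_covBy J.2
      exact ⟨⟨p, hp⟩, Subtype.ext hpJ⟩
  rw [h, Nat.card_eq_fintype_card, Fintype.card_subtype]
  simp [toggleMinus]

theorem CanToggleIn.mem_sup_Iic {p q : P} {I : LowerSet P} (h : CanToggleIn p I) :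
    q ∈ I ⊔ LowerSet.Iic p ↔ q ∈ I ∨ q = p := by
  rw [LowerSet.mem_sup_iff, LowerSet.mem_Iic_iff]
  refine ⟨fun hq => or_iff_not_imp_left.2 fun hqI => ?_, fun hq => hq.imp_right fun h => h.le⟩
  have hqp := hq.resolve_left hqI
  exact le_antisymm hqp (h.2 hqI hqp)

theorem CanToggleIn.canToggleOut_sup {p : P} {I : LowerSet P} (h : CanToggleIn p I) :
    CanToggleOut p (I ⊔ LowerSet.Iic p) := by
  refine ⟨h.mem_sup_Iic.2 (Or.inr rfl), fun q hq hpq => ?_⟩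
  rcases h.mem_sup_Iic.1 hq with hq | rfl
  · exact absurd (I.lower hpq hq) h.1
  · exact le_rfl

theorem CanToggleIn.sup_erase {p : P} {I : LowerSet P} (h : CanToggleIn p I) :
    (I ⊔ LowerSet.Iic p).erase p = I := by
  ext q
  simp only [SetLike.mem_coe]
  rw [h.canToggleOut_sup.mem_erase, h.mem_sup_Iic]
  refine ⟨fun hq => hq.1.resolve_right hq.2, fun hq => ⟨Or.inl hq, ?_⟩⟩
  rintro rfl
  exact h.1 hq

theorem CanToggleOut.canToggleIn_erase {p : P} {I : LowerSet P} (h : CanToggleOut p I) :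
    CanToggleIn p (I.erase p) := by
  refine ⟨fun hp => (h.mem_erase.1 hp).2 rfl, fun q hq hqp => ?_⟩
  by_contra hpq
  exact hq (mem_lowerSet_erase.2 ⟨I.lower hqp h.1, hpq⟩)

theorem CanToggleOut.erase_sup {p : P} {I : LowerSet P} (h : CanToggleOut p I) :
    I.erase p ⊔ LowerSet.Iic p = I := by
  ext q
  simp only [SetLike.mem_coe]
  rw [h.canToggleIn_erase.mem_sup_Iic, h.mem_erase]
  refine ⟨fun hq => hq.elim And.left fun hq => hq ▸ h.1, fun hq => ?_⟩
  by_cases hqp : q = p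
  · exact Or.inr hqp
  · exact Or.inl ⟨hq, hqp⟩

/-- Adding and erasing `p` are mutually inverse bijections between the ideals into which `p` can be
toggled and those out of which it can. -/
theorem uniformDist_isToggleSymmetric [Fintype P] :
    IsToggleSymmetric (uniformDist (LowerSet P)) := by
  classical
  intro p
  simp only [expectation, uniformDist, ← Finset.sum_mul, togglePlus, toggleMinus,
    Finset.sum_boole]
  congr 2
  refine Finset.card_nbij' (fun I => I ⊔ LowerSet.Iic p) (fun I => I.erase p) ?_ ?_ ?_ ?_
  · intro I hI
    simpa using CanToggleIn.canToggleOut_sup (by simpa using hI)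
  · intro I hI
    simpa using CanToggleOut.canToggleIn_erase (by simpa using hI)
  · intro I hI
    exact CanToggleIn.sup_erase (by simpa using hI)
  · intro I hI
    exact CanToggleOut.erase_sup (by simpa using hI)

theorem uniformDist_mem_stdSimplex (α : Type*) [Fintype α] [Nonempty α] :
    uniformDist α ∈ stdSimplex ℝ α := by
  refine ⟨fun _ => by unfold uniformDist; positivity, ?_⟩
  simp [uniformDist]

/-- If the down-degree is a constant up to a linear combination of the signed toggleability
statistics, then its expectation is that constant for every toggle-symmetric distribution. -/
theorem expectation_ddeg_of_toggle_combination [Fintype P] (c : P → ℝ) (K : ℝ)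
    (h : ∀ I : LowerSet P, ∑ p, (togglePlus p I * c p + toggleMinus p I * (1 - c p)) = K)
    (μ : LowerSet P → ℝ) (hμ : μ ∈ stdSimplex ℝ (LowerSet P)) (hs : IsToggleSymmetric μ) :
    expectation μ (fun I => (ddeg I : ℝ)) = K := by
  have h1 : ∀ I : LowerSet P, (ddeg I : ℝ) * μ I
      = K * μ I + ∑ p, c p * (toggleMinus p I * μ I - togglePlus p I * μ I) := fun I => by
    rw [ddeg_lowerSet, ← h I, Finset.sum_mul, Finset.sum_mul, ← Finset.sum_add_distrib]
    exact Finset.sum_congr rfl fun p _ => by ring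
  have h2 : ∀ p : P, ∑ I, c p * (toggleMinus p I * μ I - togglePlus p I * μ I) = 0 := fun p => by
    have h3 := hs p
    simp only [expectation] at h3
    rw [← Finset.mul_sum, Finset.sum_sub_distrib, h3, sub_self, mul_zero]
  simp only [expectation]
  rw [Finset.sum_congr rfl fun I _ => h1 I, Finset.sum_add_distrib, ← Finset.mul_sum, hμ.2,
    Finset.sum_comm, Finset.sum_congr rfl fun p _ => h2 p]
  simp

theorem edgeDensity_of_toggle_combination [Fintype P] (c : P → ℝ) (K : ℝ)
    (h : ∀ I : LowerSet P, ∑ p, (togglePlus p I * c p + toggleMinus p I * (1 - c p)) = K) :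
    edgeDensity (LowerSet P) = K :=
  expectation_ddeg_of_toggle_combination c K h _ (uniformDist_mem_stdSimplex _)
    uniformDist_isToggleSymmetric

theorem orderIdealsToggleCDE_of_toggle_combination [Fintype P] (c : P → ℝ) (K : ℝ)
    (h : ∀ I : LowerSet P, ∑ p, (togglePlus p I * c p + toggleMinus p I * (1 - c p)) = K) :
    OrderIdealsToggleCDE P := fun μ hμ hs =>
  (expectation_ddeg_of_toggle_combination c K h μ hμ hs).trans
    (edgeDensity_of_toggle_combination c K h).symm

end OrderIdeals

theorem ddeg_orderIso {α β : Type*} [PartialOrder α] [PartialOrder β] (e : α ≃o β) (a : α) :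
    ddeg (e a) = ddeg a :=
  (Nat.card_congr (e.toEquiv.subtypeEquiv (p := (· ⋖ a)) (q := (· ⋖ e a))
    fun _ => (apply_covBy_apply_iff e).symm)).symm

theorem edgeDensity_orderIso {α β : Type*} [PartialOrder α] [PartialOrder β] [Fintype α]
    [Fintype β] (e : α ≃o β) : edgeDensity α = edgeDensity β := by
  simp only [edgeDensity, expectation, uniformDist, Fintype.card_congr e.toEquiv]
  exact Fintype.sum_equiv e.toEquiv _ _ fun a => by
    simp only [OrderIso.coe_toEquiv, ddeg_orderIso]


/-! ### Shifted shapes: the interval below a strict partition as `J(P)` -/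

section ShiftedShapes

/-- The right ends of the nonempty rows of a shifted shape weakly decrease. -/
theorem IsStrict.add_rowLen_le {l : YoungDiagram} (hl : IsStrict l) {i j : ℕ} (hij : i ≤ j)
    (h : l.rowLen j ≠ 0) : j + l.rowLen j ≤ i + l.rowLen i := by
  induction j, hij using Nat.le_induction with
  | base => exact le_rfl
  | succ j hij ih =>
    have h1 := l.rowLen_anti j (j + 1) (Nat.le_succ j)
    have h2 := hl j (by omega)
    have h3 := ih (by omega)
    omega

/-- The boxes of the shifted shape of `l`, in the form (row, position in the row). -/
def ShiftedBox (l : YoungDiagram) : Type := {c : ℕ × ℕ // c ∈ l.cells}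

namespace ShiftedBox

variable {l : YoungDiagram}

instance : Fintype (ShiftedBox l) := inferInstanceAs (Fintype {c : ℕ × ℕ // c ∈ l.cells})

/-- The row of a box; its column is `p.row + p.pos`. -/
def row (p : ShiftedBox l) : ℕ := p.1.1

/-- The position of a box in its row. -/
def pos (p : ShiftedBox l) : ℕ := p.1.2

theorem ext {p q : ShiftedBox l} (h1 : p.row = q.row) (h2 : p.pos = q.pos) : p = q :=
  Subtype.ext (Prod.ext h1 h2)

/-- Boxes are ordered by row and column. -/
instance : PartialOrder (ShiftedBox l) :=
  PartialOrder.lift (fun p => (p.row, p.row + p.pos)) fun p q h => by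
    simp only [Prod.mk.injEq] at h
    exact ext h.1 (by omega)

theorem le_iff {p q : ShiftedBox l} :
    p ≤ q ↔ p.row ≤ q.row ∧ p.row + p.pos ≤ q.row + q.pos := Iff.rfl

theorem pos_lt (p : ShiftedBox l) : p.pos < l.rowLen p.row :=
  YoungDiagram.mem_iff_lt_rowLen.1 ((YoungDiagram.mem_cells _).1 p.2)

/-- The box in row `i` at position `t`. -/
def mk {i t : ℕ} (h : t < l.rowLen i) : ShiftedBox l :=
  ⟨(i, t), (YoungDiagram.mem_cells _).2 (YoungDiagram.mem_iff_lt_rowLen.2 h)⟩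

@[simp] theorem row_mk {i t : ℕ} (h : t < l.rowLen i) : (mk h).row = i := rfl

@[simp] theorem pos_mk {i t : ℕ} (h : t < l.rowLen i) : (mk h).pos = t := rfl

end ShiftedBox

open ShiftedBox

/-- The order ideal of the boxes of a strict partition `r`. -/
def shiftedIdeal (l : YoungDiagram) (r : StrictPartition) : LowerSet (ShiftedBox l) where
  carrier := {p | p.pos < r.1.rowLen p.row}
  lower' := by
    intro p q hqp hp
    simp only [Set.mem_ofPred_eq] at hp ⊢
    rw [le_iff] at hqp
    have := r.2.add_rowLen_le hqp.1 (by omega)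
    omega

theorem mem_shiftedIdeal {l : YoungDiagram} {r : StrictPartition} {p : ShiftedBox l} :
    p ∈ shiftedIdeal l r ↔ p.pos < r.1.rowLen p.row := Iff.rfl

theorem le_iff_rowLen_le {m l : YoungDiagram} : m ≤ l ↔ ∀ i, m.rowLen i ≤ l.rowLen i := by
  refine ⟨fun h i => ?_, fun h => ?_⟩
  · refine le_of_forall_lt fun j hj => ?_
    exact YoungDiagram.mem_iff_lt_rowLen.1 (h (YoungDiagram.mem_iff_lt_rowLen.2 hj))
  · rintro ⟨i, j⟩ hij
    exact YoungDiagram.mem_iff_lt_rowLen.2 ((YoungDiagram.mem_iff_lt_rowLen.1 hij).trans_le (h i))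

theorem rowLen_le_of_mem {l : StrictPartition} (r : ShiftedInterval l) (i : ℕ) :
    r.1.1.rowLen i ≤ l.1.rowLen i := le_iff_rowLen_le.1 r.2.2 i

theorem shiftedIdeal_le_iff {l : StrictPartition} (r s : ShiftedInterval l) :
    shiftedIdeal l.1 r.1 ≤ shiftedIdeal l.1 s.1 ↔ r ≤ s := by
  refine Iff.trans ⟨fun h i => ?_, fun h p hp => ?_⟩ le_iff_rowLen_le.symm
  · refine le_of_forall_lt fun j hj => ?_
    have hmem : mk (hj.trans_le (rowLen_le_of_mem r i)) ∈ shiftedIdeal l.1 r.1 := hj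
    exact h hmem
  · exact mem_shiftedIdeal.2 ((mem_shiftedIdeal.1 hp).trans_le (h p.row))

theorem shiftedIdeal_surjective (l : StrictPartition) :
    Function.Surjective fun r : ShiftedInterval l => shiftedIdeal l.1 r.1 := by
  classical
  intro I
  have hfilter : ∀ c : ℕ × ℕ, c ∈ l.1.cells.filter
      (fun c => ∃ h : c ∈ l.1.cells, (⟨c, h⟩ : ShiftedBox l.1) ∈ I) ↔
      ∃ h : c.2 < l.1.rowLen c.1, mk h ∈ I := fun c => by
    rw [Finset.mem_filter]
    exact ⟨fun ⟨_, h, hI⟩ => ⟨pos_lt ⟨c, h⟩, hI⟩, fun ⟨h, hI⟩ => ⟨(mk h).2, (mk h).2, hI⟩⟩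
  let r : YoungDiagram :=
    { cells := l.1.cells.filter (fun c => ∃ h : c ∈ l.1.cells, (⟨c, h⟩ : ShiftedBox l.1) ∈ I)
      isLowerSet := by
        rintro ⟨i, t⟩ ⟨i', t'⟩ ⟨hi, ht⟩ hc
        rw [Finset.mem_coe, hfilter] at hc ⊢
        obtain ⟨h, hI⟩ := hc
        simp only at h hI hi ht
        have h1 := l.1.rowLen_anti i' i hi
        have h2 : t' < l.1.rowLen i' := by omega
        have h3 : mk h2 ≤ mk h :=
          le_iff.2 ⟨hi, by simp only [row_mk, pos_mk]; omega⟩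
        exact ⟨h2, I.lower h3 hI⟩ }
  have hr : ∀ i t, t < r.rowLen i ↔ ∃ h : t < l.1.rowLen i, mk h ∈ I := fun i t => by
    rw [← YoungDiagram.mem_iff_lt_rowLen, ← YoungDiagram.mem_cells]
    exact hfilter (i, t)
  have hrl : ∀ i, r.rowLen i ≤ l.1.rowLen i := fun i =>
    le_of_forall_lt fun t ht => ((hr i t).1 ht).1
  have hstrict : IsStrict r := by
    intro i hi
    by_contra hle
    -- If row `i + 1` were at least as long as row `i`, its box at position `r.rowLen i - 1` would
    -- lie directly below the first box of row `i` missing from `I`.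
    have h1 : r.rowLen i - 1 < r.rowLen (i + 1) := by omega
    obtain ⟨h2, hI⟩ := (hr _ _).1 h1
    have h3 := l.2 i (by have := hrl i; omega)
    have h4 := hrl (i + 1)
    have h5 : r.rowLen i < l.1.rowLen i := by omega
    exact lt_irrefl _ ((hr i _).2 ⟨h5, I.lower (le_iff.2 ⟨by simp, by
      simp only [row_mk, pos_mk]; omega⟩) hI⟩)
  refine ⟨⟨⟨r, hstrict⟩, ⟨bot_le (a := r), le_iff_rowLen_le.2 hrl⟩⟩, ?_⟩
  ext p
  exact (hr p.row p.pos).trans ⟨fun h => h.2, fun h => ⟨p.pos_lt, h⟩⟩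

/-- The interval `[∅, l]` of the shifted Young's lattice is the distributive lattice of order
ideals of the poset of boxes of the shifted shape of `l`. -/
noncomputable def shiftedIntervalOrderIso (l : StrictPartition) :
    ShiftedInterval l ≃o LowerSet (ShiftedBox l.1) :=
  RelIso.ofSurjective (OrderEmbedding.ofMapLEIff _ shiftedIdeal_le_iff)
    (shiftedIdeal_surjective l)

/-! ### Addable and removable boxes of a strict partition -/

/-- Only the left and upper neighbours matter. The upper neighbour of position `t` is at position `t
+ 1` of the previous row, because rows are shifted. -/
theorem canToggleIn_shiftedIdeal {l : StrictPartition} (r : ShiftedInterval l)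
    (p : ShiftedBox l.1) :
    CanToggleIn p (shiftedIdeal l.1 r.1) ↔ p.pos = r.1.1.rowLen p.row ∧
      (p.row = 0 ∨ r.1.1.rowLen p.row + 1 < r.1.1.rowLen (p.row - 1)) := by
  have hp := p.pos_lt
  have hle := rowLen_le_of_mem r
  constructor
  · intro h
    have h0 : r.1.1.rowLen p.row ≤ p.pos := not_lt.1 h.1
    have h1 : p.pos = r.1.1.rowLen p.row := by
      by_contra hne
      have h2 : p.pos - 1 < l.1.rowLen p.row := by omega
      have h3 := h.2 (y := mk h2)
        (fun hmem => by rw [mem_shiftedIdeal] at hmem; simp only [row_mk, pos_mk] at hmem; omega)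
        (le_iff.2 ⟨le_rfl, by simp only [row_mk, pos_mk]; omega⟩)
      have := (le_iff.1 h3).2
      simp only [row_mk, pos_mk] at this
      omega
    refine ⟨h1, or_iff_not_imp_left.2 fun hrow => ?_⟩
    by_contra hlt
    have h2 := l.2 (p.row - 1)
      (by have := l.1.rowLen_anti (p.row - 1) p.row (Nat.sub_le _ _); omega)
    rw [Nat.sub_add_cancel (Nat.pos_of_ne_zero hrow)] at h2
    have h3 : p.pos + 1 < l.1.rowLen (p.row - 1) := by omega
    have h4 := h.2 (y := mk h3)
      (fun hmem => by rw [mem_shiftedIdeal] at hmem; simp only [row_mk, pos_mk] at hmem; omega)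
      (le_iff.2 ⟨Nat.sub_le _ _, by simp only [row_mk, pos_mk]; omega⟩)
    have := (le_iff.1 h4).1
    simp only [row_mk] at this
    omega
  · rintro ⟨h1, h2⟩
    refine ⟨fun hmem => ?_, fun q hq hqp => le_iff.2 ?_⟩
    · rw [mem_shiftedIdeal] at hmem
      omega
    · replace hq : ¬ q.pos < r.1.1.rowLen q.row := hq
      rw [le_iff] at hqp
      rcases hqp.1.eq_or_lt with heq | hlt
      · rw [heq] at hq hqp ⊢
        omega
      · have h3 := r.1.2.add_rowLen_le (Nat.le_sub_one_of_lt hlt) (by omega)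
        omega

/-- Only the right and lower neighbours matter. The lower one is at position `t - 1` of the next
row, and a diagonal box (`t = 0`) has none. -/
theorem canToggleOut_shiftedIdeal {l : StrictPartition} (r : ShiftedInterval l)
    (p : ShiftedBox l.1) :
    CanToggleOut p (shiftedIdeal l.1 r.1) ↔ p.pos + 1 = r.1.1.rowLen p.row ∧
      (p.pos = 0 ∨ r.1.1.rowLen (p.row + 1) < p.pos) := by
  have hle := rowLen_le_of_mem r
  constructor
  · intro h
    have h0 : p.pos < r.1.1.rowLen p.row := h.1
    have h1 : p.pos + 1 = r.1.1.rowLen p.row := by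
      by_contra hne
      have h2 : p.pos + 1 < l.1.rowLen p.row := by have := hle p.row; omega
      have h3 := h.2 (y := mk h2)
        (mem_shiftedIdeal.2 (by simp only [row_mk, pos_mk]; omega))
        (le_iff.2 ⟨le_rfl, by simp only [row_mk, pos_mk]; omega⟩)
      have := (le_iff.1 h3).2
      simp only [row_mk, pos_mk] at this
      omega
    refine ⟨h1, or_iff_not_imp_left.2 fun hpos => ?_⟩
    by_contra hlt
    have h3 : p.pos - 1 < l.1.rowLen (p.row + 1) := by have := hle (p.row + 1); omega
    have h4 := h.2 (y := mk h3)
      (mem_shiftedIdeal.2 (by simp only [row_mk, pos_mk]; omega))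
      (le_iff.2 ⟨Nat.le_succ _, by simp only [row_mk, pos_mk]; omega⟩)
    have := (le_iff.1 h4).1
    simp only [row_mk] at this
    omega
  · rintro ⟨h1, h2⟩
    refine ⟨mem_shiftedIdeal.2 (by omega), fun q hq hpq => le_iff.2 ?_⟩
    replace hq : q.pos < r.1.1.rowLen q.row := hq
    rw [le_iff] at hpq
    rcases hpq.1.eq_or_lt with heq | hlt
    · rw [← heq] at hq hpq ⊢
      omega
    · have h3 := r.1.2.add_rowLen_le (Nat.succ_le_of_lt hlt) (by omega)
      have h4 := r.1.1.rowLen_anti _ _ (Nat.succ_le_of_lt hlt)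
      have h5 := r.1.2 p.row (by omega)
      simp only [Nat.succ_eq_add_one] at h3 h4
      omega

theorem sum_shiftedBox (l : YoungDiagram) (f : ℕ → ℕ → ℝ) {N : ℕ} (hN : l.colLen 0 ≤ N) :
    ∑ p : ShiftedBox l, f p.row p.pos
      = ∑ i ∈ Finset.range N, ∑ t ∈ Finset.range (l.rowLen i), f i t := by
  have h1 : ∑ p : ShiftedBox l, f p.row p.pos = ∑ c ∈ l.cells, f c.1 c.2 :=
    Finset.sum_coe_sort l.cells fun c => f c.1 c.2
  rw [h1]
  refine Finset.sum_finset_product' _ _ _ fun c => ?_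
  rw [YoungDiagram.mem_cells, YoungDiagram.mem_iff_lt_rowLen, Finset.mem_range, Finset.mem_range]
  refine ⟨fun h => ⟨?_, h⟩, fun h => h.2⟩
  by_contra hc
  rw [rowLen_eq_zero_of_colLen_le l c.1 (by omega)] at h
  exact absurd h (Nat.not_lt_zero _)

end ShiftedShapes


/-! ### Shifted-balanced shapes and the telescoping sum -/

/-- A strict partition `l` with nonempty shifted shape is *shifted-balanced* if all the outward
corners of the southeast border of its shifted shape lie on the anti-diagonal through the northeast
end of the border; if the border starts with an east step on the main diagonal, then that starting
point has to lie on the next anti-diagonal. -/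
structure IsShiftedBalanced (l : StrictPartition) : Prop where
  nonempty : l.1.rowLen 0 ≠ 0
  corner : ∀ i, l.1.rowLen (i + 1) ≠ 0 → l.1.rowLen (i + 1) + 1 < l.1.rowLen i →
    l.1.rowLen 0 = 2 * (i + 1) + l.1.rowLen (i + 1)
  corner_diagonal : ∀ i, l.1.rowLen (i + 1) = 0 → 1 < l.1.rowLen i →
    l.1.rowLen 0 + 1 = 2 * (i + 1)

/-- The coefficient of the signed toggleability statistic at the box in row `i` at position `t` of
a shifted-balanced shape with first part `s`. -/
noncomputable def toggleWeight (s i t : ℕ) : ℝ :=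
  if t = 0 then ((s : ℝ) + 1 - 2 * i) / 4 else ((s : ℝ) - 2 * i - t) / 2

/-- The part of the total toggle weight that comes from below the `i`-th row end of a strict
partition whose `i`-th part is `a`. -/
noncomputable def toggleWeightBelow (s i a : ℕ) : ℝ :=
  if a = 0 then 0 else (2 * ((i : ℝ) + a) - s + 1) / 4

theorem sum_range_ite_eq_and (L a : ℕ) (Q : ℕ → Prop) [DecidablePred Q] (g : ℕ → ℝ) :
    ∑ t ∈ Finset.range L, (if t = a ∧ Q t then g t else 0) = if a < L ∧ Q a then g a else 0 := by
  simp_rw [ite_and]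
  rw [Finset.sum_ite_eq' (Finset.range L) a fun t => if Q t then g t else 0]
  simp only [Finset.mem_range]

section

variable {l : StrictPartition}

/-- The contribution of the box that can be toggled into row `i`. -/
noncomputable def rowPlus (r : ShiftedInterval l) (i : ℕ) : ℝ :=
  if r.1.1.rowLen i < l.1.rowLen i ∧ (i = 0 ∨ r.1.1.rowLen i + 1 < r.1.1.rowLen (i - 1)) then
    toggleWeight (l.1.rowLen 0) i (r.1.1.rowLen i) else 0

/-- The contribution of the box that can be toggled out of row `i`. -/
noncomputable def rowMinus (r : ShiftedInterval l) (i : ℕ) : ℝ :=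
  if r.1.1.rowLen i ≠ 0 ∧ (r.1.1.rowLen i = 1 ∨ r.1.1.rowLen (i + 1) + 1 < r.1.1.rowLen i) then
    1 - toggleWeight (l.1.rowLen 0) i (r.1.1.rowLen i - 1) else 0

/-- When row `0` is full, the missing term would have had weight `(s - s) / 2 = 0`, so no balance
condition is needed at the northeast end. Nonemptiness provides the box to add when the row is
empty. -/
theorem rowPlus_zero_add (hl : IsShiftedBalanced l) (r : ShiftedInterval l) :
    rowPlus r 0 + toggleWeightBelow (l.1.rowLen 0) 0 (r.1.1.rowLen 0)
      = ((l.1.rowLen 0 : ℝ) + 1) / 4 := by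
  have h0 := hl.nonempty
  have h1 := rowLen_le_of_mem r 0
  unfold rowPlus toggleWeightBelow toggleWeight
  by_cases ha : r.1.1.rowLen 0 = 0
  · rw [if_pos ⟨by omega, Or.inl rfl⟩, if_pos ha, if_pos ha]
    push_cast
    ring
  · rw [if_neg ha, if_neg ha]
    rcases h1.eq_or_lt with h2 | h2
    · rw [if_neg (by omega), h2]
      push_cast
      ring
    · rw [if_pos ⟨h2, Or.inl rfl⟩]
      push_cast
      ring

theorem rowMinus_add_rowPlus_succ (hl : IsShiftedBalanced l) (r : ShiftedInterval l) (i : ℕ) :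
    rowMinus r i + rowPlus r (i + 1)
      = toggleWeightBelow (l.1.rowLen 0) i (r.1.1.rowLen i)
        - toggleWeightBelow (l.1.rowLen 0) (i + 1) (r.1.1.rowLen (i + 1)) := by
  have h1 := rowLen_le_of_mem r i
  have h2 := rowLen_le_of_mem r (i + 1)
  have h3 := r.1.2 i
  have h4 := l.2 i
  have h5 := r.1.1.rowLen_anti i (i + 1) (Nat.le_succ i)
  have hc := hl.corner i
  have hd := hl.corner_diagonal i
  unfold rowMinus rowPlus toggleWeightBelow toggleWeight
  simp only [Nat.add_sub_cancel]
  generalize r.1.1.rowLen i = a at *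
  generalize r.1.1.rowLen (i + 1) = b at *
  generalize l.1.rowLen i = A at *
  generalize l.1.rowLen (i + 1) = B at *
  generalize l.1.rowLen 0 = s at *
  by_cases ha : a = 0
  · have hb : b = 0 := by omega
    subst ha hb
    simp
  by_cases hb : b = 0
  · subst hb
    by_cases ha1 : a = 1
    · subst ha1
      simp
      ring
    · obtain ⟨a, rfl⟩ : ∃ a', a = a' + 2 := ⟨a - 2, by omega⟩
      rw [if_pos (by omega), if_neg (by omega), if_neg ha, if_pos rfl, if_pos rfl]
      by_cases hB : B = 0
      · rw [if_neg (by omega)]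
        -- The diagonal box that could start row `i + 1` is outside the shape; `corner_diagonal`
        -- makes its weight vanish.
        have h6 : (s : ℝ) + 1 = 2 * (i + 1) := by exact_mod_cast hd hB (by omega)
        rw [show a + 2 - 1 = a + 1 from rfl]
        push_cast
        linarith
      · rw [if_pos (by omega), show a + 2 - 1 = a + 1 from rfl]
        push_cast
        ring
  · obtain ⟨a, rfl⟩ : ∃ a', a = a' + 2 := ⟨a - 2, by omega⟩
    rw [show a + 2 - 1 = a + 1 from rfl, if_neg (show ¬ a + 1 = 0 by omega), if_neg ha, if_neg hb,
      if_neg hb]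
    by_cases hab : b + 1 < a + 2
    · rw [if_pos (by omega)]
      by_cases hbB : b < B
      · rw [if_pos (by omega)]
        push_cast
        ring
      · rw [if_neg (by omega)]
        have hbB' : b = B := by omega
        -- Row `i + 1` is full, so the box extending it is outside the shape; `corner` makes its
        -- weight vanish.
        have h6 : (s : ℝ) = 2 * (i + 1) + b := by
          rw [hbB']
          exact_mod_cast hc (by omega) (by omega)
        push_cast
        linarith
    -- The two rows end in the same column: neither box can be toggled, and the two row-end terms
    -- agree.
    · rw [if_neg (by omega), if_neg (by omega)]
      have h6 : (a : ℝ) + 1 = b := by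
        have : a + 1 = b := by omega
        exact_mod_cast this
      push_cast
      linarith

/-- Each row has at most one addable and at most one removable box. -/
theorem sum_toggles_eq_sum_rows (r : ShiftedInterval l) (N : ℕ) (hN : l.1.colLen 0 ≤ N) :
    ∑ p : ShiftedBox l.1, (togglePlus p (shiftedIdeal l.1 r.1)
        * toggleWeight (l.1.rowLen 0) p.row p.pos
      + toggleMinus p (shiftedIdeal l.1 r.1) * (1 - toggleWeight (l.1.rowLen 0) p.row p.pos))
      = ∑ i ∈ Finset.range N, (rowPlus r i + rowMinus r i) := by
  classical
  have hp : ∀ p : ShiftedBox l.1, togglePlus p (shiftedIdeal l.1 r.1)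
        * toggleWeight (l.1.rowLen 0) p.row p.pos = if p.pos = r.1.1.rowLen p.row ∧
          (p.row = 0 ∨ r.1.1.rowLen p.row + 1 < r.1.1.rowLen (p.row - 1)) then
        toggleWeight (l.1.rowLen 0) p.row p.pos else 0 := fun p => by
    simp only [togglePlus, canToggleIn_shiftedIdeal, ite_mul, one_mul, zero_mul]
  -- The position is solved for to suit `sum_range_ite_eq_and`; the nonzero row length guards the
  -- truncated subtraction.
  have hm : ∀ p : ShiftedBox l.1, toggleMinus p (shiftedIdeal l.1 r.1)
        * (1 - toggleWeight (l.1.rowLen 0) p.row p.pos) = if p.pos = r.1.1.rowLen p.row - 1 ∧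
          (r.1.1.rowLen p.row ≠ 0 ∧ (p.pos = 0 ∨ r.1.1.rowLen (p.row + 1) < p.pos)) then
        1 - toggleWeight (l.1.rowLen 0) p.row p.pos else 0 := fun p => by
    simp only [toggleMinus, canToggleOut_shiftedIdeal, ite_mul, one_mul, zero_mul]
    refine if_congr ?_ rfl rfl
    omega
  simp_rw [hp, hm]
  rw [sum_shiftedBox l.1 (fun i t =>
    (if t = r.1.1.rowLen i ∧ (i = 0 ∨ r.1.1.rowLen i + 1 < r.1.1.rowLen (i - 1)) then
        toggleWeight (l.1.rowLen 0) i t else 0)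
    + if t = r.1.1.rowLen i - 1 ∧ (r.1.1.rowLen i ≠ 0 ∧ (t = 0 ∨ r.1.1.rowLen (i + 1) < t)) then
        1 - toggleWeight (l.1.rowLen 0) i t else 0) hN]
  refine Finset.sum_congr rfl fun i _ => ?_
  rw [Finset.sum_add_distrib, sum_range_ite_eq_and, sum_range_ite_eq_and]
  have hle := rowLen_le_of_mem r i
  refine congrArg₂ (· + ·) rfl (if_congr ?_ rfl rfl)
  omega

theorem sum_toggles_shiftedIdeal (hl : IsShiftedBalanced l) (r : ShiftedInterval l) :
    ∑ p : ShiftedBox l.1, (togglePlus p (shiftedIdeal l.1 r.1)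
        * toggleWeight (l.1.rowLen 0) p.row p.pos
      + toggleMinus p (shiftedIdeal l.1 r.1) * (1 - toggleWeight (l.1.rowLen 0) p.row p.pos))
      = ((l.1.rowLen 0 : ℝ) + 1) / 4 := by
  have hN := rowLen_eq_zero_of_colLen_le l.1 _ le_rfl
  rw [sum_toggles_eq_sum_rows r _ le_rfl]
  generalize l.1.colLen 0 = N at hN
  have hrN : r.1.1.rowLen N = 0 := Nat.le_zero.1 (hN ▸ rowLen_le_of_mem r N)
  -- Row `N` of the shape is empty, so the `rowPlus` terms can be shifted by one row to pair with
  -- the `rowMinus` terms.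
  have hlast : rowPlus r N = 0 := if_neg (by omega)
  have hshift := (Finset.sum_range_succ (rowPlus r) N).symm.trans
    (Finset.sum_range_succ' (rowPlus r) N)
  rw [hlast, add_zero] at hshift
  rw [Finset.sum_add_distrib, hshift, add_right_comm, ← Finset.sum_add_distrib,
    Finset.sum_congr rfl fun i _ => (add_comm _ _).trans (rowMinus_add_rowPlus_succ hl r i),
    Finset.sum_range_sub' fun i => toggleWeightBelow (l.1.rowLen 0) i (r.1.1.rowLen i), hrN,
    ← rowPlus_zero_add hl r]
  simp only [toggleWeightBelow, if_true]
  ring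

end

/-- Shifted-balanced shapes have toggle-CDE intervals. -/
theorem IsShiftedBalanced.isToggleCDE_and_edgeDensity {l : StrictPartition}
    (hl : IsShiftedBalanced l) : IsToggleCDE (ShiftedInterval l) ∧
      edgeDensity (ShiftedInterval l) = ((l.1.rowLen 0 : ℝ) + 1) / 4 := by
  have h : ∀ I : LowerSet (ShiftedBox l.1), ∑ p, (togglePlus p I
        * toggleWeight (l.1.rowLen 0) p.row p.pos
      + toggleMinus p I * (1 - toggleWeight (l.1.rowLen 0) p.row p.pos))
      = ((l.1.rowLen 0 : ℝ) + 1) / 4 := fun I => by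
    obtain ⟨r, rfl⟩ := shiftedIdeal_surjective l I
    exact sum_toggles_shiftedIdeal hl r
  exact ⟨⟨ShiftedBox l.1, inferInstance, inferInstance, ⟨shiftedIntervalOrderIso l⟩,
      orderIdealsToggleCDE_of_toggle_combination _ _ h⟩,
    (edgeDensity_orderIso (shiftedIntervalOrderIso l)).trans
      (edgeDensity_of_toggle_combination _ _ h)⟩

/-! ### The two families of shifted-balanced shapes -/

/-- The descents of a balanced partition of equal height and width `k` lie on the anti-diagonal. -/
theorem IsBalanced.add_rowLen_eq {ν : YoungDiagram} {k : ℕ} (hbal : IsBalanced ν)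
    (hheight : height ν = k) (hwidth : width ν = k) {i : ℕ}
    (hi : ν.rowLen (i + 1) < ν.rowLen i) : i + 1 + ν.rowLen (i + 1) = k := by
  have hik : i < k := by
    by_contra hik
    have h1 := rowLen_eq_zero_of_colLen_le ν i (by unfold height at hheight; omega)
    omega
  -- For `i + 1 = k` the point is the start `(k, 0)` of the border: it is not a corner, but lies on
  -- the line anyway.
  rcases (Nat.succ_le_of_lt hik).eq_or_lt with heq | hlt
  · have h1 := rowLen_eq_zero_of_colLen_le ν (i + 1) (by unfold height at hheight; omega)
    omega
  · have hw : ν.rowLen 0 = k := hwidth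
    have h0 := ν.rowLen_anti 0 i (Nat.zero_le i)
    have hcol : ν.colLen (ν.rowLen (i + 1)) = i + 1 := by
      have h1 : i < ν.colLen (ν.rowLen (i + 1)) :=
        YoungDiagram.mem_iff_lt_colLen.1 (YoungDiagram.mem_iff_lt_rowLen.2 hi)
      refine le_antisymm (not_lt.1 fun h2 => ?_) h1
      have h3 := YoungDiagram.mem_iff_lt_rowLen.1 (YoungDiagram.mem_iff_lt_colLen.2 h2)
      exact lt_irrefl _ h3
    have h2 := hbal (i + 1) (ν.rowLen (i + 1))
      ⟨⟨by rw [hheight]; exact hlt, rfl⟩, ⟨by rw [hwidth]; omega, hcol⟩⟩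
    rw [hheight, hwidth, ← add_mul] at h2
    exact Nat.eq_of_mul_eq_mul_right (by omega) h2

theorem rowLen_eq_zero_of_height_le {ν : YoungDiagram} {k : ℕ} (hheight : height ν = k) {i : ℕ}
    (hi : k ≤ i) : ν.rowLen i = 0 :=
  rowLen_eq_zero_of_colLen_le ν i (le_of_eq_of_le hheight hi)

theorem rowLen_stairPlus (n : ℕ) (ν : YoungDiagram) (h : height ν ≤ n) (i : ℕ) :
    (stairPlus n ν h).1.rowLen i = n - i + ν.rowLen i := by
  simp only [stairPlus, rowLen_partitionAdd, rowLen_staircase]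

theorem rowLen_stairPlusRect (n b : ℕ) (ν : YoungDiagram) (h : height ν ≤ n) (i : ℕ) :
    (stairPlusRect n b ν h).1.rowLen i = n - i + ν.rowLen i + if i < n then b else 0 := by
  simp only [stairPlusRect, rowLen_partitionAdd, rowLen_staircase, rowLen_rectangle]

/-- A gap larger than one between nonzero consecutive parts comes from a descent of `ν`, and adding
the staircase turns `i + 1 + ν.rowLen (i + 1) = k` into the required equation with `s = n + k`. -/
theorem isShiftedBalanced_stairPlus {n k : ℕ} (hkn : k < n) {ν : YoungDiagram}
    (hbal : IsBalanced ν) (hheight : height ν = k) (hwidth : width ν = k) :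
    IsShiftedBalanced (stairPlus n ν (hheight.trans_le hkn.le)) := by
  have hw : ν.rowLen 0 = k := hwidth
  refine ⟨?_, fun i h1 h2 => ?_, fun i h1 h2 => ?_⟩
  · rw [rowLen_stairPlus]
    omega
  · simp only [rowLen_stairPlus] at h1 h2 ⊢
    have hz := fun h => rowLen_eq_zero_of_height_le hheight (i := i + 1) h
    have := hbal.add_rowLen_eq hheight hwidth (i := i) (by omega)
    omega
  -- Vacuous: the last nonzero part is `1`, since `k < n`.
  · simp only [rowLen_stairPlus] at h1 h2 ⊢
    have hz := fun h => rowLen_eq_zero_of_height_le hheight (i := i) h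
    omega

theorem isShiftedBalanced_stairPlusRect {n k : ℕ} (hkn : k < n) {ν : YoungDiagram}
    (hbal : IsBalanced ν) (hheight : height ν = k) (hwidth : width ν = k) :
    IsShiftedBalanced (stairPlusRect n (n - 1 - k) ν (hheight.trans_le hkn.le)) := by
  have hw : ν.rowLen 0 = k := hwidth
  refine ⟨?_, fun i h1 h2 => ?_, fun i h1 h2 => ?_⟩
  · rw [rowLen_stairPlusRect]
    omega
  · simp only [rowLen_stairPlusRect] at h1 h2 ⊢
    have hz := fun h => rowLen_eq_zero_of_height_le hheight (i := i + 1) h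
    have hi : i + 1 < n := by
      by_contra hi
      rw [if_neg hi] at h1
      omega
    rw [if_pos hi, if_pos (by omega)] at h2
    have := hbal.add_rowLen_eq hheight hwidth (i := i) (by omega)
    rw [if_pos hi, if_pos (by omega)]
    omega
  · simp only [rowLen_stairPlusRect] at h1 h2 ⊢
    have hz := fun h => rowLen_eq_zero_of_height_le hheight (i := i) h
    -- Only `i = n - 1` survives; there `s + 1 = 2 * n`, which is what forces the rectangle width `n
    -- - 1 - k`.
    split_ifs at h1 h2 ⊢ <;> omega

theorem mainTheorem1 (n k : ℕ) (hkn : k < n) (ν : YoungDiagram) (hbal : IsBalanced ν)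
    (hheight : height ν = k) (hwidth : width ν = k) :
    (IsToggleCDE (ShiftedInterval (stairPlus n ν (hheight.trans_le hkn.le))) ∧
      edgeDensity (ShiftedInterval (stairPlus n ν (hheight.trans_le hkn.le)))
        = ((n : ℝ) + 1 + (k : ℝ)) / 4) ∧
    (IsToggleCDE (ShiftedInterval (stairPlusRect n (n - 1 - k) ν (hheight.trans_le hkn.le))) ∧
      edgeDensity (ShiftedInterval (stairPlusRect n (n - 1 - k) ν (hheight.trans_le hkn.le)))
        = (n : ℝ) / 2) := by
  have hw : ν.rowLen 0 = k := hwidth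
  have h1 := (isShiftedBalanced_stairPlus hkn hbal hheight hwidth).isToggleCDE_and_edgeDensity
  have h2 := (isShiftedBalanced_stairPlusRect hkn hbal hheight hwidth).isToggleCDE_and_edgeDensity
  refine ⟨⟨h1.1, h1.2.trans ?_⟩, ⟨h2.1, h2.2.trans ?_⟩⟩
  · rw [rowLen_stairPlus, hw, Nat.sub_zero]
    push_cast
    ring
  · have h3 : n - 0 + k + (n - 1 - k) + 1 = 2 * n := by omega
    rw [rowLen_stairPlusRect, hw, if_pos (by omega)]
    have h4 : ((n - 0 + k + (n - 1 - k) : ℕ) : ℝ) + 1 = 2 * n := by exact_mod_cast h3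
    rw [h4]
    ring
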